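/- A doodle diagram is a connected $4$-valent plane graph $D$ (loops and parallel edges allowed, at least one vertex) on the sphere $S^2$. Its vertices are called crossings, and its regions are the components of $S^2\setminus D$; they are the $2$-cells of a cell subdivision of $S^2$ with $1$-skeleton $D$. The diagram is minimal if no region is a monogon or a bigon, that is, no region has a boundary curve consisting of exactly one or exactly two edges. It is prime if it is $3$-connected, that is, it has more than $3$ vertices and the removal of fewer than $3$ vertices never disconnects it. For a region $R$ (chosen as the infinite region), the inner complement $R^c$ is the closed subcomplex of this cell subdivision consisting of all vertices, closed edges and closed regions that are disjoint from the boundary of $R$. Theorem 4.3. Let $D$ be a minimal prime doodle diagram on the sphere. Then for every region $R$ of $D$ the inner complement $R^c$ is acyclic, in the sense that $H_1(R^c;\mathbb Z)=0$, and $R^c$ contains at least one region. -/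

import Mathlib

/-- A connected doodle diagram on the sphere with at least one crossing, regarded as a connected
4-valent plane graph (loops and parallel edges allowed) and recorded by its combinatorial map.
`D` is the set of darts (half-edges; a dart is also an edge together with a direction, starting at
the vertex to which the half-edge is attached).  `vertexPerm` sends a dart to the next one in the
counterclockwise order around its vertex and `edgePerm` sends a dart to the opposite half of the
same edge.  The cell subdivision of a closed oriented surface obtained by gluing discs along the
face cycles is a sphere exactly when its Euler characteristic is two. -/
structure DoodleDiagram (D : Type*) [Fintype D] where
  /-- the next dart counterclockwise around the same vertex -/
  vertexPerm : Equiv.Perm D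
  /-- the other half of the same edge, that is, the edge traversed backwards -/
  edgePerm : Equiv.Perm D
  edgePerm_edgePerm : ∀ d, edgePerm (edgePerm d) = d
  edgePerm_ne : ∀ d, edgePerm d ≠ d
  /-- every vertex has valency four -/
  fourValent : ∀ d, {e | vertexPerm.SameCycle d e}.ncard = 4
  /-- the diagram is connected -/
  connected : ∀ d e, ∃ g ∈ Subgroup.closure {vertexPerm, edgePerm}, g d = e
  /-- the underlying surface is the sphere: `V - E + F = 2`; the faces are the cycles of
  `vertexPerm⁻¹ * edgePerm` -/
  spherical :
    Nat.card (Quotient (Equiv.Perm.SameCycle.setoid vertexPerm)) +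
      Nat.card (Quotient (Equiv.Perm.SameCycle.setoid (vertexPerm⁻¹ * edgePerm))) =
    Nat.card (Quotient (Equiv.Perm.SameCycle.setoid edgePerm)) + 2

namespace DoodleDiagram

variable {D : Type*} [Fintype D] (M : DoodleDiagram D)

/-- Go along a dart to its end and take the next dart clockwise from the reversed one: this is the
next dart on the boundary curve of the region on the left of the given dart. -/
def facePerm : Equiv.Perm D := M.vertexPerm⁻¹ * M.edgePerm

/-- The vertices (crossings) of the diagram. -/
def Vertex : Type _ := Quotient (Equiv.Perm.SameCycle.setoid M.vertexPerm)

/-- The edges of the diagram. -/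
def Edge : Type _ := Quotient (Equiv.Perm.SameCycle.setoid M.edgePerm)

/-- The regions of the diagram, i.e. the components of its complement in the sphere. -/
def Region : Type _ := Quotient (Equiv.Perm.SameCycle.setoid M.facePerm)

/-- The vertex from which a dart starts. -/
def origin (d : D) : M.Vertex := Quotient.mk (Equiv.Perm.SameCycle.setoid M.vertexPerm) d

/-- The vertex at which a dart ends. -/
def target (d : D) : M.Vertex := M.origin (M.edgePerm d)

/-- The edge that contains a dart. -/
def edge (d : D) : M.Edge := Quotient.mk (Equiv.Perm.SameCycle.setoid M.edgePerm) d

/-- The region on the left of a dart. -/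
def region (d : D) : M.Region := Quotient.mk (Equiv.Perm.SameCycle.setoid M.facePerm) d

/-- The number of edges in the boundary curve of a region: an `i`-gon has boundary length `i`. -/
noncomputable def boundaryLength (F : M.Region) : ℕ := {d | M.region d = F}.ncard

/-- The vertices on the boundary of a region. -/
def boundaryVertices (F : M.Region) : Set M.Vertex := {v | ∃ d, M.region d = F ∧ M.origin d = v}

/-- The diagram is minimal: it has no monogons and no bigons. -/
def IsMinimal : Prop := ∀ F : M.Region, M.boundaryLength F ≠ 1 ∧ M.boundaryLength F ≠ 2

/-- The simple graph of adjacency between distinct vertices, forgetting loops and multiplicities. -/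
def graph : SimpleGraph M.Vertex where
  Adj u v := u ≠ v ∧ ∃ d, M.origin d = u ∧ M.target d = v
  symm := ⟨by
    rintro u v ⟨h, d, rfl, rfl⟩
    exact ⟨h.symm, M.edgePerm d, rfl, by simp [target, M.edgePerm_edgePerm]⟩⟩
  loopless := ⟨fun _ h => h.1 rfl⟩

/-- The diagram is `k`-connected: it has more than `k` vertices and is not disconnected whenever
fewer than `k` vertices are removed. -/
def IsKConnected (k : ℕ) : Prop :=
  k < Nat.card M.Vertex ∧
    ∀ S : Set M.Vertex, S.ncard < k → (M.graph.induce Sᶜ).Connected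

/-- A diagram is prime if it is 3-connected. -/
def IsPrime : Prop := M.IsKConnected 3

/-- A closed subcomplex of the cell subdivision of the sphere defined by the diagram. -/
structure Subcomplex where
  vertices : Set M.Vertex
  edges : Set M.Edge
  regions : Set M.Region
  origin_mem : ∀ d, M.edge d ∈ edges → M.origin d ∈ vertices
  edge_mem : ∀ d, M.region d ∈ regions → M.edge d ∈ edges

theorem edge_edgePerm (d : D) : M.edge (M.edgePerm d) = M.edge d :=
  Quotient.sound (s := Equiv.Perm.SameCycle.setoid M.edgePerm)
    (Equiv.Perm.sameCycle_apply_left.2 (Equiv.Perm.SameCycle.refl _ _))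

theorem region_facePerm (d : D) : M.region (M.facePerm d) = M.region d :=
  Quotient.sound (s := Equiv.Perm.SameCycle.setoid M.facePerm)
    (Equiv.Perm.sameCycle_apply_left.2 (Equiv.Perm.SameCycle.refl _ _))

theorem origin_vertexPerm (d : D) : M.origin (M.vertexPerm d) = M.origin d :=
  Quotient.sound (s := Equiv.Perm.SameCycle.setoid M.vertexPerm)
    (Equiv.Perm.sameCycle_apply_left.2 (Equiv.Perm.SameCycle.refl _ _))

theorem origin_facePerm (d : D) : M.origin (M.facePerm d) = M.target d := by
  rw [← M.origin_vertexPerm (M.facePerm d)]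
  simp [facePerm, target]

/-- The inner complement of the region `R`: all vertices, (closed) edges and (closed) regions that
have no point in common with the boundary of `R`.  As two closed cells that meet have a vertex in
common, these are the cells none of whose vertices lies on the boundary of `R`. -/
def innerComplement (R : M.Region) : M.Subcomplex where
  vertices := {v | v ∉ M.boundaryVertices R}
  edges := {e | ∀ d, M.edge d = e → M.origin d ∉ M.boundaryVertices R}
  regions := {F | ∀ d, M.region d = F → M.origin d ∉ M.boundaryVertices R}
  origin_mem := fun d h => h d rfl
  edge_mem := by
    intro d h d' hd'
    have hc : M.edgePerm.SameCycle d' d :=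
      Quotient.exact (s := Equiv.Perm.SameCycle.setoid M.edgePerm) hd'
    have hcases : d' = d ∨ d' = M.edgePerm d := by
      obtain ⟨i, rfl⟩ := hc
      have hsq : M.edgePerm * M.edgePerm = 1 := Equiv.ext M.edgePerm_edgePerm
      have h2 : M.edgePerm ^ (2 : ℤ) = 1 := by
        rw [zpow_two, hsq]
      rcases Int.even_or_odd i with ⟨j, hj⟩ | ⟨j, hj⟩
      · left
        have : M.edgePerm ^ i = 1 := by rw [hj, ← two_mul, zpow_mul, h2, one_zpow]
        simp [this]
      · right
        have : M.edgePerm ^ i = M.edgePerm := by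
          rw [hj, zpow_add, zpow_mul, h2, one_zpow, one_mul, zpow_one]
        simp [this, M.edgePerm_edgePerm]
    rcases hcases with rfl | rfl
    · exact h _ rfl
    · have := h (M.facePerm d) (M.region_facePerm d)
      rwa [M.origin_facePerm] at this

/-! ### Cellular chains with integer coefficients

A 2-chain is a function on regions (each oriented counterclockwise).  A 1-chain is an antisymmetric
function on darts; an oriented edge `d` is the function with value `1` at `d`, value `-1` at the
reversed dart and value `0` elsewhere.  A 0-chain is a function on vertices. -/

/-- The boundary of a 2-chain: the coefficient of the edge `d` is that of the region on its left
minus that of the region on its right. -/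
def boundary₂ : (M.Region → ℤ) →ₗ[ℤ] (D → ℤ) where
  toFun g d := g (M.region d) - g (M.region (M.edgePerm d))
  map_add' f g := by
    funext d
    simp only [Pi.add_apply]
    ring
  map_smul' c g := by
    funext d
    simp only [Pi.smul_apply, smul_eq_mul, RingHom.id_apply]
    ring

open Classical in
/-- The boundary of a 1-chain; the oriented edge `d` has boundary `target d - origin d`. -/
noncomputable def boundary₁ : (D → ℤ) →ₗ[ℤ] (M.Vertex → ℤ) where
  toFun f v := ∑ d, if M.target d = v then f d else 0
  map_add' f g := by
    funext v
    simp only [Pi.add_apply, ← Finset.sum_add_distrib]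
    refine Finset.sum_congr rfl fun d _ => ?_
    split_ifs <;> simp
  map_smul' c f := by
    funext v
    simp only [Pi.smul_apply, smul_eq_mul, RingHom.id_apply, Finset.mul_sum]
    refine Finset.sum_congr rfl fun d _ => ?_
    split_ifs <;> simp

theorem boundary₁_boundary₂ (g : M.Region → ℤ) : M.boundary₁ (M.boundary₂ g) = 0 := by
  classical
  funext v
  have h1 : ∑ d, (if M.target d = v then g (M.region d) else 0) =
      ∑ d, (if M.origin d = v then g (M.region d) else 0) := by
    rw [← Equiv.sum_comp M.facePerm (fun d => if M.origin d = v then g (M.region d) else 0)]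
    simp only [M.origin_facePerm, M.region_facePerm]
  have h2 : ∑ d, (if M.target d = v then g (M.region (M.edgePerm d)) else 0) =
      ∑ d, (if M.origin d = v then g (M.region d) else 0) :=
    Equiv.sum_comp M.edgePerm (fun d => if M.origin d = v then g (M.region d) else 0)
  have h3 : M.boundary₁ (M.boundary₂ g) v =
      ∑ d, (if M.target d = v then g (M.region d) else 0) -
        ∑ d, (if M.target d = v then g (M.region (M.edgePerm d)) else 0) := by
    rw [← Finset.sum_sub_distrib]
    refine Finset.sum_congr rfl fun d _ => ?_
    simp only [boundary₂, LinearMap.coe_mk, AddHom.coe_mk]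
    split_ifs <;> simp
  rw [h3, h1, h2, sub_self]
  rfl

namespace Subcomplex

variable {M} (K : M.Subcomplex)

/-- The cellular 2-chains of a subcomplex. -/
def chains₂ : Submodule ℤ (M.Region → ℤ) where
  carrier := {g | ∀ F, F ∉ K.regions → g F = 0}
  zero_mem' := by simp
  add_mem' := by
    intro f g hf hg F hF
    simp [hf F hF, hg F hF]
  smul_mem' := by
    intro c g hg F hF
    simp [hg F hF]

/-- The cellular 1-chains of a subcomplex. -/
def chains₁ : Submodule ℤ (D → ℤ) where
  carrier := {f | (∀ d, f (M.edgePerm d) = -f d) ∧ ∀ d, M.edge d ∉ K.edges → f d = 0}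
  zero_mem' := by simp
  add_mem' := by
    intro f g hf hg
    refine ⟨fun d => ?_, fun d hd => ?_⟩
    · simp only [Pi.add_apply, hf.1 d, hg.1 d]
      ring
    · simp [hf.2 d hd, hg.2 d hd]
  smul_mem' := by
    intro c f hf
    refine ⟨fun d => ?_, fun d hd => ?_⟩
    · simp [hf.1 d]
    · simp [hf.2 d hd]

/-- The cellular 1-cycles of a subcomplex. -/
noncomputable def cycles₁ : Submodule ℤ (D → ℤ) := K.chains₁ ⊓ LinearMap.ker M.boundary₁

/-- The cellular 1-boundaries of a subcomplex. -/
def boundaries₁ : Submodule ℤ (D → ℤ) := K.chains₂.map M.boundary₂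

theorem boundaries₁_le_cycles₁ : K.boundaries₁ ≤ K.cycles₁ := by
  rintro _ ⟨g, hg, rfl⟩
  refine ⟨⟨fun d => ?_, fun d hd => ?_⟩, M.boundary₁_boundary₂ g⟩
  · simp only [boundary₂, LinearMap.coe_mk, AddHom.coe_mk, M.edgePerm_edgePerm]
    ring
  · have h1 : g (M.region d) = 0 := hg _ fun h => hd (K.edge_mem d h)
    have h2 : g (M.region (M.edgePerm d)) = 0 :=
      hg _ fun h => hd (M.edge_edgePerm d ▸ K.edge_mem _ h)
    simp [boundary₂, h1, h2]

/-- The first cellular homology group, with integer coefficients, of a subcomplex. -/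
abbrev H₁ : Type _ := K.cycles₁ ⧸ K.boundaries₁.submoduleOf K.cycles₁

end Subcomplex

end DoodleDiagram

/-!
Integer functions on the corners of the diagram whose sums around every vertex and inside every
region vanish are the increments of functions on the edges: by `V - E + F = 2`, the dimensions
leave no room for anything else.  Applied to the corner function read off from a cellular cycle,
this gives `H₁(S²) = 0`; a 2-chain on the sphere bounding a cycle of `Rᶜ` is constant on the regions
that touch `R`, so subtracting this constant pushes it into `Rᶜ`.  Applied to a closed curve that
crosses the diagram only at one or two vertices, it is a Jordan curve theorem.  By 3-connectedness
such a curve has all the other vertices on one side, so a region has only one corner at each of its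
vertices, and two regions that share two vertices share an edge between them, as there are no
bigons.

Let `R` be an `n`-gon.  An edge between two vertices of `R` lies on `R`, so `2n` darts lead into
`∂R` from outside.  A vertex outside `∂R` emits at most two of them, since three consecutive ones
would give two neighbouring triangles on `R` with a common vertex of valency three.  Hence
`2n ≤ 2(V - n)`.  If every region touched `R`, there would be at most `2n + 1 ≤ V + 1` regions,
whereas there are `V + 2`.
-/

open Module Finset

section Generic

variable {D X A : Type*} {d e : D} {σ : Equiv.Perm D}

theorem apply_eq_of_sameCycle [Finite D] {t : D → X} (ht : ∀ x, σ.SameCycle d x → t (σ x) = t x)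
    (h : σ.SameCycle d e) : t d = t e := by
  obtain ⟨n, rfl⟩ := h.exists_nat_pow_eq
  induction n with
  | zero => rfl
  | succ n ih =>
    have hn : σ.SameCycle d ((σ ^ n) d) := ⟨n, rfl⟩
    rw [ih hn, pow_succ', Equiv.Perm.mul_apply, ht _ hn]

theorem eq_or_eq_of_sameCycle [Finite D] (hd : σ (σ d) = d) (h : σ.SameCycle d e) :
    e = d ∨ e = σ d := by
  obtain ⟨n, rfl⟩ := h.exists_nat_pow_eq
  induction n with
  | zero => exact Or.inl rfl
  | succ n ih =>
    rw [pow_succ', Equiv.Perm.mul_apply]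
    rcases ih ⟨n, rfl⟩ with h | h <;> simp [h, hd]

theorem sum_fiber_comp_perm [Fintype D] [DecidableEq X] [AddCommMonoid A] {p : D → X}
    (hp : ∀ d, p (σ d) = p d) (w : D → A) (x : X) :
    ∑ d with p d = x, w (σ d) = ∑ d with p d = x, w d :=
  sum_equiv σ (by simp [hp]) fun _ _ => rfl

theorem sum_mul_comp_eq_zero [Fintype D] [Finite X] [DecidableEq X] [NonUnitalNonAssocSemiring A]
    {p : D → X} {c : D → A} (hc : ∀ x, ∑ d with p d = x, c d = 0) (q : X → A) :
    ∑ d, c d * q (p d) = 0 := by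
  have := Fintype.ofFinite X
  rw [← sum_fiberwise univ p]
  refine sum_eq_zero fun x _ => ?_
  rw [← zero_mul (q x), ← hc x, sum_mul]
  exact sum_congr rfl fun d hd => by rw [(mem_filter.1 hd).2]

theorem ncard_preimage_eq_mul [Finite D] {p : D → X} {t : Set X} {k : ℕ}
    (hp : ∀ x ∈ t, {d | p d = x}.ncard = k) (ht : t.Finite) :
    (p ⁻¹' t).ncard = t.ncard * k := by
  classical
  have := Fintype.ofFinite D
  lift t to Finset X using ht
  rw [Set.ncard_coe_finset, Set.ncard_eq_toFinset_card',
    card_eq_sum_card_fiberwise (t := t) (f := p) (by simp [Set.MapsTo]), sum_const_nat]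
  intro x hx
  rw [← hp x hx, Set.ncard_eq_toFinset_card']
  congr 1
  ext d
  simpa using fun h => h ▸ hx

theorem ncard_le_mul_of_mapsTo [Finite D] [Finite X] {p : D → X} {s : Set D} {t : Set X} {k : ℕ}
    (hst : Set.MapsTo p s t) (hp : ∀ x ∈ t, {d ∈ s | p d = x}.ncard ≤ k) :
    s.ncard ≤ t.ncard * k := by
  classical
  have := Fintype.ofFinite D
  have := Fintype.ofFinite X
  rw [Set.ncard_eq_toFinset_card', Set.ncard_eq_toFinset_card', mul_comm]
  refine card_le_mul_card_image_of_maps_to (f := p) (by simpa [Set.MapsTo] using hst) k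
    fun x hx => ?_
  rw [← Set.ncard_coe_finset]
  convert hp x (by simpa using hx) using 2
  ext d
  simp

end Generic

section LinearAlgebra

variable {K V W ι : Type*} [Field K]

theorem finrank_le_finrank_range_add_one [AddCommGroup V] [Module K V] [AddCommGroup W] [Module K W]
    [FiniteDimensional K V] {f : V →ₗ[K] W} {x : V} (hf : LinearMap.ker f ≤ K ∙ x) :
    finrank K V ≤ finrank K (LinearMap.range f) + 1 := by
  rw [← f.finrank_range_add_finrank_ker]
  have h := (Submodule.finrank_mono hf).trans (finrank_span_le_card {x})
  simpa using h

theorem mem_of_dotProduct_eq_zero [Fintype ι] [LinearOrder K] [IsStrictOrderedRing K]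
    {U W : Submodule K (ι → K)} (horth : ∀ u ∈ U, ∀ w ∈ W, u ⬝ᵥ w = 0)
    (hdim : Fintype.card ι ≤ finrank K U + finrank K W) {c : ι → K}
    (hc : ∀ w ∈ W, c ⬝ᵥ w = 0) : c ∈ U := by
  have hdisj : Disjoint U W := Submodule.disjoint_def.2 fun x hU hW =>
    dotProduct_self_eq_zero.1 (horth x hU x hW)
  have htop := Submodule.eq_top_of_disjoint U W (by simpa using hdim) hdisj
  obtain ⟨u, hu, w, hw, rfl⟩ := Submodule.mem_sup.1 (htop ▸ Submodule.mem_top : c ∈ U ⊔ W)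
  have hww : w ⬝ᵥ w = 0 := by simpa [add_dotProduct, horth u hu w hw] using hc w hw
  rwa [dotProduct_self_eq_zero.1 hww, add_zero]

end LinearAlgebra

namespace DoodleDiagram

variable {D : Type*} [Fintype D]

section Basic

variable (M : DoodleDiagram D)

instance : Finite M.Vertex := Quotient.finite _
instance : Finite M.Edge := Quotient.finite _
instance : Finite M.Region := Quotient.finite _

theorem origin_surjective : Function.Surjective M.origin := Quotient.mk_surjective
theorem edge_surjective : Function.Surjective M.edge := Quotient.mk_surjective
theorem region_surjective : Function.Surjective M.region := Quotient.mk_surjective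

theorem vertexPerm_facePerm (d : D) : M.vertexPerm (M.facePerm d) = M.edgePerm d := by
  simp [facePerm]

theorem facePerm_edgePerm_vertexPerm (d : D) : M.facePerm (M.edgePerm (M.vertexPerm d)) = d := by
  simp [facePerm, M.edgePerm_edgePerm]

theorem region_edgePerm_vertexPerm (d : D) :
    M.region (M.edgePerm (M.vertexPerm d)) = M.region d := by
  rw [← M.region_facePerm, M.facePerm_edgePerm_vertexPerm]

theorem target_edgePerm (d : D) : M.target (M.edgePerm d) = M.origin d := by
  rw [target, M.edgePerm_edgePerm]

theorem eq_of_invariant {X : Type*} {t : D → X} (hv : ∀ d, t (M.vertexPerm d) = t d)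
    (he : ∀ d, t (M.edgePerm d) = t d) (d e : D) : t d = t e := by
  obtain ⟨g, hg, rfl⟩ := M.connected d e
  induction hg using Subgroup.closure_induction generalizing d with
  | mem x hx =>
    rcases hx with rfl | rfl
    · exact (hv d).symm
    · exact (he d).symm
  | one => rfl
  | mul x y _ _ hx hy => rw [Equiv.Perm.mul_apply, ← hx (y d), ← hy d]
  | inv x _ hx => simpa using (hx (x⁻¹ d)).symm

theorem nonempty_dart (M : DoodleDiagram D) : Nonempty D := by
  by_contra h
  rw [not_nonempty_iff] at h
  have := M.spherical
  simp at this

variable {M} {d e : D}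

theorem facePerm_eq_of_edgePerm_eq (h : M.edgePerm d = M.vertexPerm e) : M.facePerm d = e :=
  M.vertexPerm.injective ((M.vertexPerm_facePerm d).trans h)

theorem origin_eq_iff : M.origin d = M.origin e ↔ M.vertexPerm.SameCycle d e := Quotient.eq

theorem edge_eq_iff : M.edge d = M.edge e ↔ e = d ∨ e = M.edgePerm d := by
  refine ⟨fun h => eq_or_eq_of_sameCycle (M.edgePerm_edgePerm d) (Quotient.exact h), ?_⟩
  rintro (rfl | rfl)
  · rfl
  · exact (M.edge_edgePerm d).symm

theorem region_eq_iff : M.region d = M.region e ↔ M.facePerm.SameCycle d e := Quotient.eq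

variable (M)

theorem ncard_origin_eq (u : M.Vertex) : {d | M.origin d = u}.ncard = 4 := by
  obtain ⟨a, rfl⟩ := M.origin_surjective u
  simpa only [← origin_eq_iff, eq_comm] using M.fourValent a

theorem ncard_edge_eq (E : M.Edge) : {d | M.edge d = E}.ncard = 2 := by
  obtain ⟨a, rfl⟩ := M.edge_surjective E
  have h : {d | M.edge d = M.edge a} = {a, M.edgePerm a} := by
    ext d
    simpa [eq_comm] using edge_eq_iff (d := a) (e := d)
  rw [h, Set.ncard_pair (M.edgePerm_ne a).symm]

theorem card_dart_eq_vertex : Nat.card D = Nat.card M.Vertex * 4 := by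
  simpa using ncard_preimage_eq_mul (fun u _ => M.ncard_origin_eq u) Set.finite_univ

theorem card_dart_eq_edge : Nat.card D = Nat.card M.Edge * 2 := by
  simpa using ncard_preimage_eq_mul (fun E _ => M.ncard_edge_eq E) Set.finite_univ

theorem card_region_eq : Nat.card M.Region = Nat.card M.Vertex + 2 := by
  have h : Nat.card M.Vertex + Nat.card M.Region = Nat.card M.Edge + 2 := M.spherical
  have h₁ := M.card_dart_eq_vertex
  have h₂ := M.card_dart_eq_edge
  omega

end Basic

section Potential

variable {A : Type*} [AddCommGroup A] (M : DoodleDiagram D)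

/-- The dart `d` stands for the corner at `origin d` between `d` and the next dart
`vertexPerm d`, which lies in `region d`.  A function `h` on edges, encoded as a function on darts
that agrees on the two halves of each edge, is a potential of a function `c` on corners if `c d` is
the increment of `h` across the corner `d`. -/
def IsPotential (h c : D → A) : Prop :=
  (∀ d, h (M.edgePerm d) = h d) ∧ ∀ d, h (M.vertexPerm d) - h d = c d

open Classical in
/-- A function on corners is a cocycle if its sum around each vertex and inside each region
vanishes.  These are the cellular cocycles of the medial graph with discs glued in. -/
def IsCocycle (c : D → A) : Prop :=
  (∀ u, ∑ d with M.origin d = u, c d = 0) ∧ ∀ F, ∑ d with M.region d = F, c d = 0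

variable {M}

theorem IsPotential.isCocycle {h c : D → A} (hc : M.IsPotential h c) : M.IsCocycle c := by
  classical
  obtain ⟨he, hv⟩ := hc
  refine ⟨fun u => ?_, fun F => ?_⟩ <;> simp only [← hv, sum_sub_distrib, sub_eq_zero]
  · exact sum_fiber_comp_perm M.origin_vertexPerm h u
  · rw [← sum_fiber_comp_perm M.region_facePerm]
    simp only [M.vertexPerm_facePerm, he]

variable (M)

/-- The increments across the corners of a function on edges. -/
def edgeIncrement : (M.Edge → ℚ) →ₗ[ℚ] (D → ℚ) :=
  LinearMap.funLeft ℚ ℚ (M.edge ∘ M.vertexPerm) - LinearMap.funLeft ℚ ℚ M.edge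

/-- The function on corners that adds a function on vertices and a function on regions. -/
def cornerSum : (M.Vertex → ℚ) × (M.Region → ℚ) →ₗ[ℚ] (D → ℚ) :=
  (LinearMap.funLeft ℚ ℚ M.origin).coprod (LinearMap.funLeft ℚ ℚ M.region)

theorem isPotential_edgeIncrement (q : M.Edge → ℚ) :
    M.IsPotential (q ∘ M.edge) (M.edgeIncrement q) :=
  ⟨fun d => by simp [M.edge_edgePerm], fun _ => rfl⟩

theorem ker_edgeIncrement_le : LinearMap.ker M.edgeIncrement ≤ ℚ ∙ 1 := by
  intro q hq
  have hv (d : D) : q (M.edge (M.vertexPerm d)) = q (M.edge d) := sub_eq_zero.1 (congrFun hq d)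
  have he (d : D) : q (M.edge (M.edgePerm d)) = q (M.edge d) := by rw [M.edge_edgePerm]
  obtain ⟨a⟩ := M.nonempty_dart
  refine Submodule.mem_span_singleton.2 ⟨q (M.edge a), funext fun E => ?_⟩
  obtain ⟨d, rfl⟩ := M.edge_surjective E
  simpa using M.eq_of_invariant (t := q ∘ M.edge) hv he a d

theorem ker_cornerSum_le : LinearMap.ker M.cornerSum ≤ ℚ ∙ (1, -1) := by
  rintro ⟨q, g⟩ hqg
  have hneg (d : D) : q (M.origin d) = -g (M.region d) :=
    eq_neg_of_add_eq_zero_left (congrFun hqg d)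
  have hv (d : D) : q (M.origin (M.vertexPerm d)) = q (M.origin d) := by rw [M.origin_vertexPerm]
  have he (d : D) : q (M.origin (M.edgePerm d)) = q (M.origin d) := by
    rw [← target, ← M.origin_facePerm, hneg, M.region_facePerm, hneg]
  obtain ⟨a⟩ := M.nonempty_dart
  have hq (d : D) : q (M.origin a) = q (M.origin d) :=
    M.eq_of_invariant (t := q ∘ M.origin) hv he a d
  refine Submodule.mem_span_singleton.2 ⟨q (M.origin a), Prod.ext (funext fun u => ?_) <|
    funext fun F => ?_⟩
  · obtain ⟨d, rfl⟩ := M.origin_surjective u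
    simpa using hq d
  · obtain ⟨d, rfl⟩ := M.region_surjective F
    simp [hq d, hneg]

theorem card_le_finrank_add_finrank : Fintype.card D ≤
    finrank ℚ (LinearMap.range M.edgeIncrement) + finrank ℚ (LinearMap.range M.cornerSum) := by
  have := Fintype.ofFinite M.Vertex
  have := Fintype.ofFinite M.Edge
  have := Fintype.ofFinite M.Region
  have h₁ := finrank_le_finrank_range_add_one M.ker_edgeIncrement_le
  have h₂ := finrank_le_finrank_range_add_one M.ker_cornerSum_le
  simp only [finrank_prod, finrank_fintype_fun_eq_card, ← Nat.card_eq_fintype_card] at h₁ h₂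
  have h₃ := M.card_dart_eq_edge
  have h₄ : Nat.card M.Vertex + Nat.card M.Region = Nat.card M.Edge + 2 := M.spherical
  rw [← Nat.card_eq_fintype_card]
  omega

variable {M} in
theorem IsCocycle.dotProduct_cornerSum {c : D → ℚ} (hc : M.IsCocycle c)
    (p : (M.Vertex → ℚ) × (M.Region → ℚ)) : c ⬝ᵥ M.cornerSum p = 0 := by
  classical
  have h : M.cornerSum p = p.1 ∘ M.origin + p.2 ∘ M.region := rfl
  rw [h, dotProduct_add]
  exact (congrArg₂ (· + ·) (sum_mul_comp_eq_zero hc.1 p.1) (sum_mul_comp_eq_zero hc.2 p.2)).trans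
    (add_zero 0)

variable {M}

theorem IsCocycle.exists_isPotential_rat {c : D → ℚ} (hc : M.IsCocycle c) :
    ∃ h, M.IsPotential h c := by
  suffices c ∈ LinearMap.range M.edgeIncrement by
    obtain ⟨q, rfl⟩ := this
    exact ⟨_, M.isPotential_edgeIncrement q⟩
  refine mem_of_dotProduct_eq_zero (W := LinearMap.range M.cornerSum) ?_
    M.card_le_finrank_add_finrank ?_
  · rintro _ ⟨q, rfl⟩ _ ⟨p, rfl⟩
    exact (M.isPotential_edgeIncrement q).isCocycle.dotProduct_cornerSum p
  · rintro _ ⟨p, rfl⟩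
    exact hc.dotProduct_cornerSum p

theorem IsCocycle.exists_isPotential {c : D → ℤ} (hc : M.IsCocycle c) :
    ∃ h, M.IsPotential h c := by
  have hcast : M.IsCocycle fun d => (c d : ℚ) :=
    ⟨fun u => by simpa using congrArg (Int.cast : ℤ → ℚ) (hc.1 u),
      fun F => by simpa using congrArg (Int.cast : ℤ → ℚ) (hc.2 F)⟩
  obtain ⟨h, he, hv⟩ := hcast.exists_isPotential_rat
  refine ⟨fun d => ⌊h d⌋, fun d => congrArg _ (he d), fun d => ?_⟩
  have hd : h (M.vertexPerm d) = c d + h d := eq_add_of_sub_eq (hv d)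
  simp only [hd, Int.floor_intCast_add, add_sub_cancel_right]

end Potential

section Sphere

variable (M : DoodleDiagram D)

theorem exists_sub_edgePerm_eq {f : D → ℤ} (hf : ∀ d, f (M.edgePerm d) = -f d) :
    ∃ w : D → ℤ, ∀ d, w d - w (M.edgePerm d) = f d := by
  classical
  obtain ⟨r, hr⟩ := M.edge_surjective.hasRightInverse
  refine ⟨fun d => if d = r (M.edge d) then f d else 0, fun d => ?_⟩
  rcases edge_eq_iff.1 (hr (M.edge d)).symm with h | h <;>
    simp [M.edge_edgePerm, h, hf, M.edgePerm_ne, (M.edgePerm_ne d).symm]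

open Classical in
theorem boundary₁_apply_eq_sum (f : D → ℤ) (u : M.Vertex) :
    M.boundary₁ f u = ∑ d with M.origin d = u, f (M.edgePerm d) := by
  rw [sum_filter]
  exact (Equiv.sum_comp M.edgePerm fun d => if M.target d = u then f d else 0).symm.trans <|
    sum_congr rfl fun d _ => by simp only [M.target_edgePerm]

theorem exists_boundary₂_eq {f : D → ℤ} (hf : ∀ d, f (M.edgePerm d) = -f d)
    (hf₁ : M.boundary₁ f = 0) : ∃ g, M.boundary₂ g = f := by
  classical
  obtain ⟨w, hw⟩ := M.exists_sub_edgePerm_eq hf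
  -- If `f = boundary₂ g`, then `w d - g (region d)` agrees on the two halves of every edge and has
  -- the following increments across the corners, so conversely `g` is found from a potential.
  have hcocycle : M.IsCocycle fun d => w (M.edgePerm (M.vertexPerm d)) - w d := by
    refine ⟨fun u => ?_, fun F => ?_⟩ <;> rw [sum_sub_distrib]
    · rw [sum_fiber_comp_perm M.origin_vertexPerm (fun d => w (M.edgePerm d)), ← sum_sub_distrib,
        ← Pi.zero_apply (M := fun _ => ℤ) u, ← hf₁, M.boundary₁_apply_eq_sum]
      exact sum_congr rfl fun d _ => by rw [hf, ← hw, neg_sub]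
    · rw [← sum_fiber_comp_perm M.region_facePerm]
      simp [M.vertexPerm_facePerm, M.edgePerm_edgePerm]
  obtain ⟨h, he, hv⟩ := hcocycle.exists_isPotential
  have hface (x : D) : w (M.facePerm x) - h (M.facePerm x) = w x - h x := by
    have hx := hv (M.facePerm x)
    simp only [M.vertexPerm_facePerm, he, M.edgePerm_edgePerm] at hx
    linarith
  obtain ⟨g, hg⟩ := (Function.factorsThrough_iff (f := M.region) (fun d => w d - h d)).1
    fun x y hxy =>
      apply_eq_of_sameCycle (t := fun d => w d - h d) (fun z _ => hface z) (region_eq_iff.1 hxy)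
  refine ⟨g, funext fun d => ?_⟩
  have hg' (x : D) : g (M.region x) = w x - h x := (congrFun hg x).symm
  simp only [boundary₂, LinearMap.coe_mk, AddHom.coe_mk, hg', he, ← hw]
  ring

theorem subsingleton_H₁_innerComplement (R : M.Region) :
    Subsingleton (M.innerComplement R).H₁ := by
  rw [Submodule.Quotient.subsingleton_iff, Submodule.submoduleOf_eq_top]
  rintro f ⟨⟨hanti, hsupp⟩, hker⟩
  obtain ⟨g, rfl⟩ := M.exists_boundary₂_eq hanti hker
  refine ⟨fun F => g F - g R, fun F hF => ?_, funext fun d => by simp [boundary₂]⟩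
  obtain ⟨d, rfl, a, rfl, had⟩ : ∃ d, M.region d = F ∧ M.origin d ∈ M.boundaryVertices R := by
    simpa [innerComplement] using hF
  refine sub_eq_zero.2 (apply_eq_of_sameCycle (t := g ∘ M.region) (fun x hx => ?_)
    (origin_eq_iff.1 had)).symm
  have hx' : M.boundary₂ g (M.vertexPerm x) = 0 := hsupp _ fun h =>
    h _ rfl ⟨a, rfl, by rw [M.origin_vertexPerm, origin_eq_iff.2 hx]⟩
  exact (sub_eq_zero.1 hx').trans (congrArg g (M.region_edgePerm_vertexPerm x))

end Sphere

section Valency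

variable {M : DoodleDiagram D} {a d : D}

variable (M a) in
theorem isCycleOn_vertexPerm : ∃ s : Finset D,
    M.vertexPerm.IsCycleOn s ∧ #s = 4 ∧ ∀ d, d ∈ s ↔ M.vertexPerm.SameCycle a d := by
  classical
  let s : Finset D := {d | M.vertexPerm.SameCycle a d}
  have hs (d : D) : d ∈ s ↔ M.vertexPerm.SameCycle a d := by simp [s]
  refine ⟨s, ⟨Equiv.bijOn' _ ?_ ?_, fun x hx y hy => ((hs x).1 hx).symm.trans ((hs y).1 hy)⟩,
    ?_, hs⟩
  · exact fun x hx => (hs _).2 (Equiv.Perm.sameCycle_apply_right.2 ((hs x).1 hx))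
  · exact fun x hx => (hs _).2 (Equiv.Perm.sameCycle_symm_apply_right.2 ((hs x).1 hx))
  · rw [← M.fourValent a, ← Set.ncard_coe_finset]
    simp [s]

theorem vertexPerm_pow_apply_eq_self_iff {n : ℕ} : (M.vertexPerm ^ n) a = a ↔ 4 ∣ n := by
  obtain ⟨s, hs, hcard, hmem⟩ := M.isCycleOn_vertexPerm a
  rw [← hcard, hs.pow_apply_eq ((hmem a).2 (.refl _ _))]

theorem eq_of_origin_eq_origin (h : M.origin d = M.origin a) :
    d = a ∨ d = M.vertexPerm a ∨ d = M.vertexPerm (M.vertexPerm a) ∨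
      d = M.vertexPerm (M.vertexPerm (M.vertexPerm a)) := by
  obtain ⟨s, hs, hcard, hmem⟩ := M.isCycleOn_vertexPerm a
  obtain ⟨n, hn, rfl⟩ :=
    hs.exists_pow_eq ((hmem a).2 (.refl _ _)) ((hmem d).2 (origin_eq_iff.1 h.symm))
  rw [hcard] at hn
  interval_cases n <;> simp [pow_succ]

variable (M a)

theorem vertexPerm_four :
    M.vertexPerm (M.vertexPerm (M.vertexPerm (M.vertexPerm a))) = a :=
  vertexPerm_pow_apply_eq_self_iff.2 dvd_rfl

theorem vertexPerm_three_ne : M.vertexPerm (M.vertexPerm (M.vertexPerm a)) ≠ a :=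
  mt (vertexPerm_pow_apply_eq_self_iff (n := 3)).1 (by decide)

theorem vertexPerm_two_ne : M.vertexPerm (M.vertexPerm a) ≠ a :=
  mt (vertexPerm_pow_apply_eq_self_iff (n := 2)).1 (by decide)

theorem vertexPerm_ne : M.vertexPerm a ≠ a :=
  mt (vertexPerm_pow_apply_eq_self_iff (n := 1)).1 (by decide)

end Valency

section Passage

/-- The crossing numbers with the corners of a closed curve that passes through a vertex from the
corner `a` to the corner `b`. -/
noncomputable def passage {X : Type*} (a b : X) : X → ℤ := by
  classical exact Pi.single a 1 - Pi.single b 1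

open Classical in
theorem passage_apply {X : Type*} (a b d : X) :
    passage a b d = (if d = a then 1 else 0) - if d = b then 1 else 0 := by
  simp [passage, Pi.single_apply]

open Classical in
theorem sum_passage {X : Type*} (p : D → X) (x : X) (a b : D) :
    ∑ d with p d = x, passage a b d = (if p a = x then 1 else 0) - if p b = x then 1 else 0 := by
  simp [passage_apply, sum_sub_distrib, sum_ite_eq']

variable {M : DoodleDiagram D}

theorem passage_apply_of_origin_ne {a b d : D} (hab : M.origin b = M.origin a)
    (hd : M.origin d ≠ M.origin a) : passage a b d = 0 := by
  simp [passage_apply, ne_of_apply_ne _ hd, ne_of_apply_ne _ (hd.trans_eq hab.symm)]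

theorem isCocycle_passage {a b : D} (ho : M.origin a = M.origin b)
    (hr : M.region a = M.region b) : M.IsCocycle (passage a b) :=
  ⟨fun u => by rw [sum_passage, ho, sub_self], fun F => by rw [sum_passage, hr, sub_self]⟩

theorem isCocycle_passage_add_passage {a a' b b' : D} (ha : M.origin a = M.origin a')
    (hb : M.origin b = M.origin b') (hr : M.region a = M.region b)
    (hr' : M.region a' = M.region b') : M.IsCocycle (passage a a' + passage b' b) := by
  refine ⟨fun u => ?_, fun F => ?_⟩ <;>
    simp_rw [Pi.add_apply, sum_add_distrib, sum_passage]
  · rw [ha, hb, sub_self, sub_self, add_zero]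
  · rw [hr, hr', sub_add_sub_cancel, sub_self]

end Passage

section Connectivity

variable {M : DoodleDiagram D}

theorem IsKConnected.exists_isPotential {k : ℕ} (hM : M.IsKConnected k) {S : Set M.Vertex}
    (hS : S.ncard < k) {c : D → ℤ} (hc : M.IsCocycle c) (hcS : ∀ d, M.origin d ∉ S → c d = 0) :
    ∃ h, M.IsPotential h c ∧ ∀ d, h d ≠ 0 → M.origin d ∈ S ∧ M.target d ∈ S := by
  obtain ⟨h, he, hv⟩ := hc.exists_isPotential
  have hvert {d e : D} (hde : M.origin d = M.origin e) (hd : M.origin d ∉ S) : h d = h e :=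
    apply_eq_of_sameCycle (fun x hx => sub_eq_zero.1 <| (hv x).trans <|
      hcS x <| origin_eq_iff.2 hx ▸ hd) (origin_eq_iff.1 hde)
  have hwalk {x y : (Sᶜ : Set M.Vertex)} (w : (M.graph.induce Sᶜ).Walk x y) {d e : D}
      (hd : M.origin d = x) (hy : M.origin e = y) : h d = h e := by
    induction w generalizing d with
    | @nil x => exact hvert (hd.trans hy.symm) (hd ▸ x.2)
    | @cons x _ _ hadj _ ih =>
      obtain ⟨-, b, hb, hb'⟩ := hadj
      rw [hvert (hd.trans hb.symm) (hd ▸ x.2), ← he b]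
      exact ih hb' hy
  have hconn := hM.2 S hS
  obtain ⟨⟨x, hx⟩⟩ := hconn.nonempty
  obtain ⟨a, rfl⟩ := M.origin_surjective x
  have hconst (d : D) (hd : M.origin d ∉ S) : h d = h a :=
    (hconn.preconnected ⟨_, hd⟩ ⟨_, hx⟩).elim fun w => hwalk w rfl rfl
  refine ⟨fun d => h d - h a, ⟨fun d => by simp only [he], fun d => by simp [hv]⟩, fun d hd => ?_⟩
  simp only [ne_eq, sub_eq_zero] at hd
  exact ⟨not_imp_comm.1 (hconst d) hd, not_imp_comm.1 (hconst (M.edgePerm d)) (by rwa [he])⟩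

theorem IsKConnected.exists_dart {k : ℕ} (hM : M.IsKConnected k) {S : Set M.Vertex}
    (hS : S.ncard < k) (u : M.Vertex) :
    ∃ d, M.origin d = u ∧ M.target d ≠ u ∧ M.target d ∉ S := by
  obtain ⟨x, hx⟩ : ∃ x, x ∉ insert u S := by
    by_contra! hall
    have hcard := Set.ncard_insert_le u S
    rw [Set.eq_univ_of_forall hall, Set.ncard_univ] at hcard
    have := hM.1
    omega
  rw [Set.mem_insert_iff, not_or] at hx
  let T : Set M.Vertex := S \ {u}
  have hu : u ∈ Tᶜ := fun h => h.2 rfl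
  have : Nontrivial (Tᶜ : Set M.Vertex) :=
    ⟨⟨u, hu⟩, ⟨x, fun h => hx.2 h.1⟩, fun h => hx.1 (congrArg Subtype.val h).symm⟩
  have hT : T.ncard < k := (Set.ncard_le_ncard Set.sdiff_subset).trans_lt hS
  obtain ⟨⟨y, hy⟩, hne, d, hd, rfl⟩ :=
    (hM.2 T hT).preconnected.exists_adj_of_nontrivial ⟨u, hu⟩
  exact ⟨d, hd, hne.symm, fun h => hy ⟨h, hne.symm⟩⟩

theorem IsPrime.target_ne_origin (hM : M.IsPrime) (a : D) : M.target a ≠ M.origin a := by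
  intro ha
  let s : Set D := {d | M.origin d = M.origin a} \ {a, M.edgePerm a}
  have hs : s.ncard = 2 := by
    rw [Set.ncard_sdiff (by rintro d (rfl | rfl) <;> [rfl; exact ha]), M.ncard_origin_eq,
      Set.ncard_pair (M.edgePerm_ne a).symm]
  have htarget : (M.target '' s).ncard < 3 := (Set.ncard_image_le).trans_lt (by omega)
  obtain ⟨d, hd, hloop, hds⟩ := IsKConnected.exists_dart hM htarget (M.origin a)
  refine hds ⟨d, ⟨hd, ?_⟩, rfl⟩
  rintro (rfl | rfl)
  · exact hloop ha
  · exact hloop (M.target_edgePerm a)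

theorem IsPrime.eq_of_region_eq (hM : M.IsPrime) {a b : D} (ho : M.origin a = M.origin b)
    (hr : M.region a = M.region b) : a = b := by
  by_contra hab
  obtain ⟨h, ⟨-, hv⟩, hS⟩ := IsKConnected.exists_isPotential hM (S := {M.origin a}) (by simp)
    (isCocycle_passage ho hr) fun d hd => passage_apply_of_origin_ne ho.symm hd
  have hzero (d : D) : h d = 0 := by
    by_contra hd
    exact hM.target_ne_origin d ((hS d hd).2.trans (hS d hd).1.symm)
  simpa [hzero, passage_apply, hab] using hv a

theorem IsMinimal.facePerm_facePerm_ne (hM : M.IsMinimal) (d : D) :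
    M.facePerm (M.facePerm d) ≠ d := by
  intro h
  have hF : {e | M.region e = M.region d} = {d, M.facePerm d} := by
    ext e
    refine ⟨fun he => eq_or_eq_of_sameCycle h (region_eq_iff.1 he.symm), ?_⟩
    rintro (rfl | rfl)
    · rfl
    · exact M.region_facePerm d
  have hlen := hM (M.region d)
  rw [boundaryLength, hF] at hlen
  by_cases hd : d = M.facePerm d
  · exact hlen.1 (by simp [← hd])
  · exact hlen.2 (Set.ncard_pair hd)

end Connectivity

section CommonEdge

variable {M : DoodleDiagram D}

theorem eq_or_eq_of_arc {a a' d₀ d₁ : D} {h : D → ℤ}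
    (ha : M.origin a' = M.origin a) (hne : a' ≠ a)
    (hv : ∀ d, M.origin d = M.origin a → h (M.vertexPerm d) - h d = passage a a' d)
    (hd₀ : M.origin d₀ = M.origin a) (hpos : 0 < h d₀)
    (hd₁ : M.origin d₁ = M.origin a) (hd₁a : d₁ ≠ a) (hzero : h d₁ = 0) :
    (a' = M.vertexPerm a ∨ a' = M.vertexPerm (M.vertexPerm a)) ∧
      ∀ d, M.origin d = M.origin a → (0 < h d ↔ d = M.vertexPerm a ∨ d = a') := by
  have h₁ := M.vertexPerm_ne a
  have h₂ := M.vertexPerm_two_ne a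
  have h₃ := M.vertexPerm_three_ne a
  have h₁₃ := M.vertexPerm_two_ne (M.vertexPerm a)
  have o₁ := M.origin_vertexPerm a
  have o₂ := (M.origin_vertexPerm (M.vertexPerm a)).trans o₁
  -- By `i₀`, `i₁`, `i₂`, `h` takes one value on the arc from `vertexPerm a` to `a'` and one less on
  -- the rest of the darts at this vertex; `d₀` and `d₁` force the values to be `1` and `0`.
  have i₀ := hv _ rfl
  have i₁ := hv _ o₁
  have i₂ := hv _ o₂
  have c₀ := eq_of_origin_eq_origin hd₀
  have c₁ := (eq_of_origin_eq_origin hd₁).resolve_left hd₁a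
  rcases (eq_of_origin_eq_origin ha).resolve_left hne with rfl | rfl | rfl <;>
    simp only [passage_apply, EmbeddingLike.apply_eq_iff_eq, ↓reduceIte, h₁, h₂, h₁.symm, h₂.symm,
      h₃.symm, h₁₃.symm, sub_self, sub_zero, zero_sub] at i₀ i₁ i₂
  · have hlow : h a = 0 := by
      rcases c₀ with rfl | rfl | rfl | rfl <;> rcases c₁ with rfl | rfl | rfl <;> omega
    refine ⟨.inl rfl, fun d hd => ?_⟩
    rcases eq_of_origin_eq_origin hd with rfl | rfl | rfl | rfl <;>
      simp [h₁, h₂, h₁.symm] <;> omega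
  · have hlow : h a = 0 := by
      rcases c₀ with rfl | rfl | rfl | rfl <;> rcases c₁ with rfl | rfl | rfl <;> omega
    refine ⟨.inr rfl, fun d hd => ?_⟩
    rcases eq_of_origin_eq_origin hd with rfl | rfl | rfl | rfl <;>
      simp [h₁, h₂, h₁.symm, h₂.symm] <;> omega
  · rcases c₀ with rfl | rfl | rfl | rfl <;> rcases c₁ with rfl | rfl | rfl <;> omega

theorem IsPrime.eq_or_eq_of_arc (hM : M.IsPrime) {a a' : D} {w : M.Vertex} {h : D → ℤ}
    (ha : M.origin a' = M.origin a) (hne : a' ≠ a)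
    (hv : ∀ d, M.origin d = M.origin a → h (M.vertexPerm d) - h d = passage a a' d)
    (hw : ∀ d, M.origin d = M.origin a → h d ≠ 0 → M.target d = w)
    (hpos : ∃ d, M.origin d = M.origin a ∧ 0 < h d) :
    (a' = M.vertexPerm a ∨ a' = M.vertexPerm (M.vertexPerm a)) ∧
      ∀ d, M.origin d = M.origin a → (0 < h d ↔ d = M.vertexPerm a ∨ d = a') := by
  obtain ⟨d₀, hd₀, hpos⟩ := hpos
  have hS : ({w, M.target a} : Set M.Vertex).ncard < 3 :=
    (Set.ncard_insert_le w {M.target a}).trans_lt (by simp)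
  obtain ⟨d₁, hd₁, -, hd₁S⟩ := IsKConnected.exists_dart hM hS (M.origin a)
  rw [Set.mem_insert_iff, Set.mem_singleton_iff, not_or] at hd₁S
  exact DoodleDiagram.eq_or_eq_of_arc ha hne hv hd₀ hpos hd₁ (fun h => hd₁S.2 (h ▸ rfl))
    (not_imp_comm.1 (hw d₁ hd₁) hd₁S.1)

theorem IsMinimal.eq_of_arcs_matched (hmin : M.IsMinimal) {a a' b b' : D}
    (hne : M.region a ≠ M.region a')
    (ha : a' = M.vertexPerm a ∨ a' = M.vertexPerm (M.vertexPerm a))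
    (hb : b = M.vertexPerm b' ∨ b = M.vertexPerm (M.vertexPerm b'))
    (hab : ∀ d, d = M.vertexPerm a ∨ d = a' →
      M.edgePerm d = M.vertexPerm b' ∨ M.edgePerm d = b)
    (hba : ∀ d, d = M.vertexPerm b' ∨ d = b →
      M.edgePerm d = M.vertexPerm a ∨ M.edgePerm d = a') :
    a' = M.vertexPerm a ∧ M.edgePerm a' = b ∧ b = M.vertexPerm b' := by
  have hinj := M.edgePerm.injective
  have hinv := M.edgePerm_edgePerm
  have hab' := hab a' (.inr rfl)
  rcases hab _ (.inl rfl) with hx | hx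
  · rcases hb with rfl | hb
    · exact ⟨hinj (hab'.elim id id |>.trans hx.symm), hab'.elim id id, rfl⟩
    · have hbx : M.edgePerm b ≠ M.vertexPerm a := fun h =>
        M.vertexPerm_ne (M.vertexPerm b') (hb ▸ (by rw [← h, hinv] at hx; exact hx))
      have hba' : M.edgePerm b = a' := (hba b (.inr rfl)).resolve_left hbx
      have hφa' : M.facePerm a' = M.vertexPerm b' :=
        facePerm_eq_of_edgePerm_eq (by rw [← hba', hinv, hb])
      have hφy : M.facePerm (M.vertexPerm b') = a :=
        facePerm_eq_of_edgePerm_eq (by rw [← hx, hinv])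
      rw [← hφy, ← hφa', M.region_facePerm, M.region_facePerm] at hne
      exact absurd rfl hne
  · rcases ha with rfl | ha
    · exact ⟨rfl, hx, hinj <| by
        rw [(hba _ (.inl rfl)).elim id id, ← hx, hinv]⟩
    · have hne' : M.edgePerm a' ≠ b := fun h =>
        M.vertexPerm_ne (M.vertexPerm a) (ha ▸ hinj (h.trans hx.symm))
      have hy : M.edgePerm a' = M.vertexPerm b' := hab'.resolve_right hne'
      have hb : b = M.vertexPerm (M.vertexPerm b') :=
        hb.resolve_left fun h => hne' (hy.trans h.symm)
      have hφx : M.facePerm (M.vertexPerm a) = M.vertexPerm b' :=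
        facePerm_eq_of_edgePerm_eq (hx.trans hb)
      have hφy : M.facePerm (M.vertexPerm b') = M.vertexPerm a :=
        facePerm_eq_of_edgePerm_eq (by rw [← hy, hinv, ha])
      exact absurd (by rw [hφx, hφy]) (hmin.facePerm_facePerm_ne (M.vertexPerm a))

theorem IsPrime.common_edge_of_pos (hM : M.IsPrime) (hmin : M.IsMinimal) {a a' b b' : D}
    (ha : M.origin a' = M.origin a) (hb : M.origin b' = M.origin b)
    (hab : M.origin b ≠ M.origin a) (hne : M.region a ≠ M.region a')
    (hr : M.region a = M.region b) (hr' : M.region a' = M.region b') {h : D → ℤ}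
    (hh : M.IsPotential h (passage a a' + passage b' b))
    (hS : ∀ d, h d ≠ 0 → M.origin d ∈ ({M.origin a, M.origin b} : Set M.Vertex) ∧
      M.target d ∈ ({M.origin a, M.origin b} : Set M.Vertex))
    (hpos : ∃ d, M.origin d = M.origin a ∧ 0 < h d) :
    a' = M.vertexPerm a ∧ M.edgePerm a' = b ∧ b = M.vertexPerm b' := by
  obtain ⟨he, hv⟩ := hh
  have hAtarget (d : D) (hd : M.origin d = M.origin a) (hd0 : h d ≠ 0) :
      M.target d = M.origin b :=
    (hS d hd0).2.resolve_left fun ht => hM.target_ne_origin d (ht.trans hd.symm)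
  have hBtarget (d : D) (hd : M.origin d = M.origin b') (hd0 : h d ≠ 0) :
      M.target d = M.origin a :=
    (hS d hd0).2.resolve_right fun ht => hM.target_ne_origin d (ht.trans (hb.symm.trans hd.symm))
  obtain ⟨hA, hAarc⟩ := hM.eq_or_eq_of_arc ha (fun h => hne (h ▸ rfl)) (fun d hd => by
    rw [hv, Pi.add_apply, passage_apply_of_origin_ne hb.symm
      (hd.trans_ne (hab.symm.trans_eq hb.symm)), add_zero]) hAtarget hpos
  have hAB (d : D) (hd : M.origin d = M.origin a) (hd0 : 0 < h d) :
      M.origin (M.edgePerm d) = M.origin b' ∧ 0 < h (M.edgePerm d) :=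
    ⟨(hAtarget d hd hd0.ne').trans hb.symm, by rwa [he]⟩
  obtain ⟨hB, hBarc⟩ := hM.eq_or_eq_of_arc (a := b') (a' := b) hb.symm
    (fun h => hne (by rw [hr, hr', h])) (fun d hd => by
      have hda : M.origin d ≠ M.origin a := (hd.trans hb).trans_ne hab
      rw [hv, Pi.add_apply, passage_apply_of_origin_ne ha hda, zero_add])
    hBtarget (hpos.imp' M.edgePerm fun d hd => hAB d hd.1 hd.2)
  refine hmin.eq_of_arcs_matched hne hA hB (fun d hd => ?_) fun d hd => ?_
  · have hd' : M.origin d = M.origin a := by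
      rcases hd with rfl | rfl <;> [exact M.origin_vertexPerm a; exact ha]
    obtain ⟨ho, hp⟩ := hAB d hd' ((hAarc d hd').2 hd)
    exact (hBarc _ ho).1 hp
  · have hd' : M.origin d = M.origin b' := by
      rcases hd with rfl | rfl <;> [exact M.origin_vertexPerm b'; exact hb.symm]
    have hp := (hBarc d hd').2 hd
    exact (hAarc _ (hBtarget d hd' hp.ne')).1 (by rwa [he])

theorem IsPrime.common_edge (hM : M.IsPrime) (hmin : M.IsMinimal) {a a' b b' : D}
    (ha : M.origin a' = M.origin a) (hb : M.origin b' = M.origin b)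
    (hab : M.origin b ≠ M.origin a) (hne : M.region a ≠ M.region a')
    (hr : M.region a = M.region b) (hr' : M.region a' = M.region b') :
    (a' = M.vertexPerm a ∧ M.edgePerm a' = b ∧ b = M.vertexPerm b') ∨
      (a = M.vertexPerm a' ∧ M.edgePerm a = b' ∧ b' = M.vertexPerm b) := by
  let S : Set M.Vertex := {M.origin a, M.origin b}
  obtain ⟨h, hh, hS⟩ := IsKConnected.exists_isPotential hM (S := S)
    (by rw [Set.ncard_pair hab.symm]; norm_num)
    (isCocycle_passage_add_passage ha.symm hb.symm hr hr') fun d hd => by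
      rw [Set.mem_insert_iff, Set.mem_singleton_iff, not_or] at hd
      rw [Pi.add_apply, passage_apply_of_origin_ne ha hd.1,
        passage_apply_of_origin_ne hb.symm (hb ▸ hd.2), add_zero]
  by_cases hpos : ∃ d, M.origin d = M.origin a ∧ 0 < h d
  · exact .inl (hM.common_edge_of_pos hmin ha hb hab hne hr hr' hh hS hpos)
  · have hinc : h (M.vertexPerm a) - h a = 1 := by
      have haa' : a ≠ a' := fun h => hne (h ▸ rfl)
      rw [hh.2, Pi.add_apply, passage_apply_of_origin_ne hb.symm (hb ▸ hab.symm)]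
      simp [passage_apply, haa']
    have hneg : h a < 0 := by
      have hle : h (M.vertexPerm a) ≤ 0 :=
        not_lt.1 fun hp => hpos ⟨_, M.origin_vertexPerm a, hp⟩
      omega
    refine .inr (hM.common_edge_of_pos hmin (h := -h) ha.symm hb.symm (by rwa [ha, hb]) hne.symm
      hr' hr ⟨fun d => by simp [hh.1], fun d => ?_⟩ (fun d hd => ?_) ⟨a, ha.symm, by simpa⟩)
    · have hd := hh.2 d
      simp only [Pi.add_apply, Pi.neg_apply, passage_apply] at hd ⊢
      linarith
    · rw [ha, hb]
      exact hS d (by simpa using hd)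

theorem IsPrime.region_eq_or_region_edgePerm_eq (hM : M.IsPrime) (hmin : M.IsMinimal)
    {R : M.Region} {d : D} (h₁ : M.origin d ∈ M.boundaryVertices R)
    (h₂ : M.target d ∈ M.boundaryVertices R) :
    M.region d = R ∨ M.region (M.edgePerm d) = R := by
  obtain ⟨a, rfl, ha⟩ := h₁
  obtain ⟨b, hab, hb⟩ := h₂
  by_contra! hR
  have hv : M.origin b ≠ M.origin a := by
    rw [ha, hb]
    exact hM.target_ne_origin d
  rcases hM.common_edge hmin (a := a) (a' := d) (b := b) (b' := M.facePerm d) ha.symm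
    ((M.origin_facePerm d).trans hb.symm) hv hR.1.symm hab.symm (M.region_facePerm d).symm with
    ⟨-, hdb, -⟩ | ⟨had, hφ, -⟩
  · exact hR.2 (by rw [hdb, hab])
  · refine hmin.facePerm_facePerm_ne d ?_
    rw [← hφ, had, facePerm_edgePerm_vertexPerm]

theorem IsPrime.region_eq_of_target_mem_of_target_mem (hM : M.IsPrime) (hmin : M.IsMinimal)
    {R : M.Region} {d : D} (hd : M.origin d ∉ M.boundaryVertices R)
    (h₀ : M.target d ∈ M.boundaryVertices R)
    (h₁ : M.target (M.vertexPerm d) ∈ M.boundaryVertices R) :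
    (∃ a, M.region a = R ∧ M.vertexPerm a = M.facePerm d) ∧
      M.region (M.vertexPerm (M.edgePerm (M.vertexPerm d))) = R := by
  obtain ⟨a, har, hao⟩ := h₀
  obtain ⟨b, hbr, hbo⟩ := h₁
  have hdR : M.region d ≠ R := fun h => hd ⟨d, h, rfl⟩
  have hface := M.facePerm_edgePerm_vertexPerm d
  have hreg := (M.region_facePerm d).trans (M.region_edgePerm_vertexPerm d).symm
  have hv : M.origin b ≠ M.origin a := by
    rw [hao, hbo]
    intro h
    refine hmin.facePerm_facePerm_ne d ?_
    rw [hM.eq_of_region_eq ((M.origin_facePerm d).trans h.symm) hreg, hface]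
  rcases hM.common_edge hmin (a := a) (a' := M.facePerm d) (b := b)
    (b' := M.edgePerm (M.vertexPerm d)) ((M.origin_facePerm d).trans hao.symm) hbo.symm hv
    (by rw [har, M.region_facePerm]; exact hdR.symm) (har.trans hbr.symm) hreg with
    ⟨ha, -, hb⟩ | ⟨-, hab, -⟩
  · exact ⟨⟨a, har, ha.symm⟩, hb ▸ hbr⟩
  · exact absurd ⟨a, har, by rw [M.edgePerm.injective hab, M.origin_vertexPerm]⟩ hd

theorem IsPrime.target_vertexPerm_vertexPerm_notMem (hM : M.IsPrime) (hmin : M.IsMinimal)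
    {R : M.Region} {d : D} (hd : M.origin d ∉ M.boundaryVertices R)
    (h₀ : M.target d ∈ M.boundaryVertices R)
    (h₁ : M.target (M.vertexPerm d) ∈ M.boundaryVertices R) :
    M.target (M.vertexPerm (M.vertexPerm d)) ∉ M.boundaryVertices R := by
  intro h₂
  obtain ⟨-, hR⟩ := hM.region_eq_of_target_mem_of_target_mem hmin hd h₀ h₁
  obtain ⟨⟨a, ha, hφ⟩, -⟩ :=
    hM.region_eq_of_target_mem_of_target_mem hmin (M.origin_vertexPerm d ▸ hd) h₁ h₂
  rw [← M.vertexPerm_facePerm, ← hφ] at hR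
  exact M.vertexPerm_three_ne a (hM.eq_of_region_eq (by simp only [M.origin_vertexPerm])
    (hR.trans ha.symm))

end CommonEdge

section Counting

variable {M : DoodleDiagram D}

variable (M) in
theorem ncard_edgePerm_preimage (s : Set D) : (M.edgePerm ⁻¹' s).ncard = s.ncard :=
  Set.ncard_preimage_of_injective_subset_range M.edgePerm.injective
    (by simp [M.edgePerm.range_eq_univ])

theorem IsPrime.ncard_boundaryVertices (hM : M.IsPrime) (R : M.Region) :
    (M.boundaryVertices R).ncard = M.boundaryLength R :=
  Set.InjOn.ncard_image fun _ ha _ hb h => hM.eq_of_region_eq h (ha.trans hb.symm)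

theorem card_region_le {R : M.Region}
    (hR : ∀ F, ∃ d, M.region d = F ∧ M.origin d ∈ M.boundaryVertices R) :
    Nat.card M.Region ≤ 2 * M.boundaryLength R + 1 := by
  let A : Set D := {a | M.region a = R}
  let across (a : D) : M.Region := M.region (M.edgePerm a)
  let opposite (a : D) : M.Region := M.region (M.vertexPerm (M.vertexPerm a))
  have hcover : Set.univ ⊆ insert R (across '' A ∪ opposite '' A) := by
    rintro F -
    obtain ⟨d, rfl, a, ha, hda⟩ := hR F
    rcases eq_of_origin_eq_origin hda.symm with rfl | rfl | rfl | rfl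
    · exact .inl ha
    · obtain ⟨b, rfl⟩ := M.facePerm.surjective a
      exact .inr (.inl ⟨b, (M.region_facePerm b).symm.trans ha, by
        simp only [across, M.vertexPerm_facePerm]⟩)
    · exact .inr (.inr ⟨a, ha, rfl⟩)
    · refine .inr (.inl ⟨a, ha, ?_⟩)
      simpa only [M.vertexPerm_four] using
        M.region_edgePerm_vertexPerm (M.vertexPerm (M.vertexPerm (M.vertexPerm a)))
  calc
    Nat.card M.Region = Set.univ.ncard := (Set.ncard_univ _).symm
    _ ≤ (insert R (across '' A ∪ opposite '' A)).ncard := Set.ncard_le_ncard hcover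
    _ ≤ (across '' A ∪ opposite '' A).ncard + 1 := Set.ncard_insert_le _ _
    _ ≤ (across '' A).ncard + (opposite '' A).ncard + 1 := by
      gcongr
      exact Set.ncard_union_le _ _
    _ ≤ A.ncard + A.ncard + 1 := by
      gcongr <;> exact Set.ncard_image_le
    _ = 2 * M.boundaryLength R + 1 := by rw [two_mul]; rfl

variable (M) in
/-- The darts that lead to a vertex on the boundary of `R` from a vertex that is not on it. -/
def inwardDarts (R : M.Region) : Set D :=
  {d | M.origin d ∉ M.boundaryVertices R ∧ M.target d ∈ M.boundaryVertices R}

theorem IsPrime.ncard_target_mem_boundaryVertices (hM : M.IsPrime) (R : M.Region) :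
    {d | M.target d ∈ M.boundaryVertices R}.ncard = M.boundaryLength R * 4 := by
  rw [← hM.ncard_boundaryVertices, ← ncard_preimage_eq_mul (p := M.origin)
    (fun u _ => M.ncard_origin_eq u) (Set.toFinite _)]
  exact M.ncard_edgePerm_preimage (M.origin ⁻¹' M.boundaryVertices R)

theorem IsPrime.two_mul_boundaryLength_le (hM : M.IsPrime) (hmin : M.IsMinimal) (R : M.Region) :
    2 * M.boundaryLength R ≤ (M.inwardDarts R).ncard := by
  let A : Set D := {d | M.region d = R}
  let A' : Set D := M.edgePerm ⁻¹' A
  have hA' : A'.ncard = M.boundaryLength R := M.ncard_edgePerm_preimage A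
  have hcover : {d | M.target d ∈ M.boundaryVertices R} ⊆ M.inwardDarts R ∪ (A ∪ A') := by
    intro d hd
    by_cases ho : M.origin d ∈ M.boundaryVertices R
    · exact .inr (hM.region_eq_or_region_edgePerm_eq hmin ho hd)
    · exact .inl ⟨ho, hd⟩
  have hle : M.boundaryLength R * 4 ≤
      (M.inwardDarts R).ncard + (M.boundaryLength R + M.boundaryLength R) := calc
    M.boundaryLength R * 4 = {d | M.target d ∈ M.boundaryVertices R}.ncard :=
      (hM.ncard_target_mem_boundaryVertices R).symm
    _ ≤ (M.inwardDarts R ∪ (A ∪ A')).ncard := Set.ncard_le_ncard hcover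
    _ ≤ (M.inwardDarts R).ncard + (A ∪ A').ncard := Set.ncard_union_le _ _
    _ ≤ (M.inwardDarts R).ncard + (A.ncard + A'.ncard) := by
      gcongr
      exact Set.ncard_union_le _ _
    _ = _ := by rw [hA']; rfl
  omega

theorem IsPrime.ncard_inwardDarts_fiber_le (hM : M.IsPrime) (hmin : M.IsMinimal) {R : M.Region}
    {u : M.Vertex} (hu : u ∉ M.boundaryVertices R) :
    {d ∈ M.inwardDarts R | M.origin d = u}.ncard ≤ 2 := by
  have hout (d : D) (hd : M.origin d = u) : ∃ m, (m = d ∨ m = M.vertexPerm d ∨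
      m = M.vertexPerm (M.vertexPerm d)) ∧ M.target m ∉ M.boundaryVertices R := by
    by_contra! hall
    exact hM.target_vertexPerm_vertexPerm_notMem hmin (hd ▸ hu) (hall d (.inl rfl))
      (hall _ (.inr (.inl rfl))) (hall _ (.inr (.inr rfl)))
  obtain ⟨d, rfl⟩ := M.origin_surjective u
  obtain ⟨m, hm, hmR⟩ := hout d rfl
  have hmu : M.origin m = M.origin d := by
    rcases hm with rfl | rfl | rfl <;> simp only [M.origin_vertexPerm]
  obtain ⟨m', hm', hmR'⟩ := hout (M.vertexPerm m) ((M.origin_vertexPerm m).trans hmu)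
  have hmu' : M.origin m' = M.origin d := by
    rcases hm' with rfl | rfl | rfl <;> simp only [M.origin_vertexPerm, hmu]
  have hne : m ≠ m' := by
    rcases hm' with rfl | rfl | rfl
    exacts [(M.vertexPerm_ne m).symm, (M.vertexPerm_two_ne m).symm,
      (M.vertexPerm_three_ne m).symm]
  have hsub : {e ∈ M.inwardDarts R | M.origin e = M.origin d} ⊆
      {e | M.origin e = M.origin d} \ {m, m'} := by
    rintro e ⟨⟨-, heR⟩, heu⟩
    refine ⟨heu, ?_⟩
    rintro (rfl | rfl)
    exacts [hmR heR, hmR' heR]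
  refine (Set.ncard_le_ncard hsub).trans_eq ?_
  rw [Set.ncard_sdiff (by rintro e (rfl | rfl) <;> assumption), M.ncard_origin_eq,
    Set.ncard_pair hne]

theorem IsPrime.ncard_inwardDarts_le (hM : M.IsPrime) (hmin : M.IsMinimal) (R : M.Region) :
    (M.inwardDarts R).ncard ≤ (M.boundaryVertices R)ᶜ.ncard * 2 :=
  ncard_le_mul_of_mapsTo (p := M.origin) (fun _ hd => hd.1)
    fun _ hu => hM.ncard_inwardDarts_fiber_le hmin hu

theorem IsPrime.regions_innerComplement_nonempty (hM : M.IsPrime) (hmin : M.IsMinimal)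
    (R : M.Region) : (M.innerComplement R).regions.Nonempty := by
  by_contra hempty
  have hmeet (F : M.Region) : ∃ d, M.region d = F ∧ M.origin d ∈ M.boundaryVertices R := by
    by_contra! hF
    exact hempty ⟨F, hF⟩
  have hregions := card_region_le hmeet
  have hEuler := M.card_region_eq
  have hlower := hM.two_mul_boundaryLength_le hmin R
  have hupper := hM.ncard_inwardDarts_le hmin R
  have hvertices := Set.ncard_add_ncard_compl (M.boundaryVertices R)
  rw [hM.ncard_boundaryVertices] at hvertices
  omega

end Counting

end DoodleDiagram

theorem theorem4p3 {D : Type*} [Fintype D] (M : DoodleDiagram D) (hmin : M.IsMinimal)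
    (hprime : M.IsPrime) (R : M.Region) :
    Subsingleton (M.innerComplement R).H₁ ∧ (M.innerComplement R).regions.Nonempty :=
  ⟨M.subsingleton_H₁_innerComplement R,
    hprime.regions_innerComplement_nonempty hmin R⟩
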